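/- Let $Z_1,\dots,Z_{d'}$ be independent standard Brownian motions on $[0,1]$ on a probability space $(\Omega,\mathcal F,P)$. Put $\Delta_n=2^{-n}$, $t_k^n=k2^{-n}$, $D_n=\{t_0^n,\dots,t_{2^n}^n\}$ and $$\Lambda_i^n(t_r^n)=Z_i(t_r^n)-Z_i(t_{r-1}^n)\quad(1\le r\le 2^n),\qquad L_{i,j}^n(k)=\sum_{r=1}^k\Lambda_i^n(t_{2r-1}^n)\Lambda_j^n(t_{2r}^n)\quad(0\le k\le 2^{n-1},\ n\ge1).$$ Let $\mathcal F_n$ be the $\sigma$-algebra generated by the increments $Z_i(t)-Z_i(s)$ with $s,t\in D_m$, $m\le n$, $1\le i\le d'$, and let $P_n(\cdot)=P(\cdot\mid\mathcal F_n)$. Fix $$\alpha\in(1/3,1/2),\quad \beta\in(1-\alpha,2\alpha),\quad \alpha'\in(\alpha,1/2),\quad \gamma\in(0,1/4],\quad \varepsilon_0\in(0,1/2),$$ indices $i\neq j$, integers $n\ge0$ and $m\ge1$, and integers $0\le k<k'\le 2^{n+m-1}$. Then, almost surely on the ($\mathcal F_n$-measurable) event that $$\max_{1\le r\le 2^n}\max\{|\Lambda_i^n(t_r^n)|,|\Lambda_j^n(t_r^n)|\}\le\Delta_n^{\alpha'}$$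 and $$\Bigl|\sum_{r=l+1}^{q}\Lambda_i^n(t_r^n)\Lambda_j^n(t_r^n)\Bigr|\le\varepsilon_0(q-l)^\beta\Delta_n^{2\alpha'}\quad\text{for all }0\le l<q\le2^n,$$ we have $$P_n\Bigl(\bigl|L_{i,j}^{n+m}(k')-L_{i,j}^{n+m}(k)\bigr|>(k'-k)^\beta\Delta_{n+m}^{2\alpha}\Bigr)\le 8\exp\Bigl(-\tfrac12\gamma\,(k'-k)^{\beta-1/2}\,\Delta_n^{2(\alpha-\alpha')}\,\Delta_m^{2\alpha-1}\Bigr).$$ -/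

import Mathlib

open MeasureTheory ProbabilityTheory

/-- `B` is a standard real Brownian motion on the time interval `[0, 1]` under `P`. -/
structure IsUnitBrownian {Ω : Type*} [MeasurableSpace Ω]
    (B : Set.Icc (0 : ℝ) 1 → Ω → ℝ) (P : Measure Ω) : Prop where
  measurable : ∀ t, Measurable (B t)
  start_zero : ∀ᵐ ω ∂P, B 0 ω = 0
  indep_increments : HasIndepIncrements B P
  gaussian_increments : ∀ s t : Set.Icc (0 : ℝ) 1, s ≤ t →
    HasLaw (fun ω => B t ω - B s ω) (gaussianReal 0 (Real.toNNReal ((t : ℝ) - (s : ℝ)))) P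
  continuous_paths : ∀ᵐ ω ∂P, Continuous (fun t => B t ω)

/-- `Z 0, …, Z (d - 1)` are independent standard Brownian motions on `[0, 1]`
(independence is that of the whole paths). -/
structure IsUnitBrownianFamily {Ω : Type*} [MeasurableSpace Ω] {d : ℕ}
    (Z : Fin d → Set.Icc (0 : ℝ) 1 → Ω → ℝ) (P : Measure Ω) : Prop where
  brownian : ∀ i, IsUnitBrownian (Z i) P
  indep : iIndepFun (fun (i : Fin d) (ω : Ω) (t : Set.Icc (0 : ℝ) 1) => Z i t ω) P

/-- The mesh `Δ_n = 2^{-n}`. -/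
noncomputable def mesh (n : ℕ) : ℝ := 1 / 2 ^ n

/-- The dyadic point `t_k^n = k / 2^n` of `[0, 1]`; it is only used for `k ≤ 2^n`, where the
projection onto `[0, 1]` does nothing. -/
noncomputable def dyadicPoint (n k : ℕ) : Set.Icc (0 : ℝ) 1 :=
  Set.projIcc 0 1 zero_le_one ((k : ℝ) / 2 ^ n)

/-- The increment `Λ_i^n(t_r^n) = Z_i(t_r^n) - Z_i(t_{r-1}^n)`, for `1 ≤ r ≤ 2^n`. -/
noncomputable def dyadicIncr {Ω : Type*} {d : ℕ} (Z : Fin d → Set.Icc (0 : ℝ) 1 → Ω → ℝ)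
    (i : Fin d) (n r : ℕ) (ω : Ω) : ℝ :=
  Z i (dyadicPoint n r) ω - Z i (dyadicPoint n (r - 1)) ω

/-- The random walk `L_{i,j}^n(k) = ∑_{r=1}^k Λ_i^n(t_{2r-1}^n) Λ_j^n(t_{2r}^n)`,
for `0 ≤ k ≤ 2^{n-1}`. -/
noncomputable def areaWalk {Ω : Type*} {d : ℕ} (Z : Fin d → Set.Icc (0 : ℝ) 1 → Ω → ℝ)
    (i j : Fin d) (n k : ℕ) (ω : Ω) : ℝ :=
  ∑ r ∈ Finset.Icc 1 k, dyadicIncr Z i n (2 * r - 1) ω * dyadicIncr Z j n (2 * r) ω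

/-- The σ-algebra `F_n` generated by the increments `Z_i(t) - Z_i(s)` of all the coordinates,
with `s, t` in the dyadic grid of order `m`, for all `m ≤ n`. -/
@[reducible] noncomputable def dyadicSigma {Ω : Type*} {d : ℕ} (Z : Fin d → Set.Icc (0 : ℝ) 1 → Ω → ℝ) (n : ℕ) :
    MeasurableSpace Ω :=
  ⨆ (m : ℕ) (_ : m ≤ n) (i : Fin d) (k : ℕ) (_ : k ≤ 2 ^ m) (l : ℕ) (_ : l ≤ 2 ^ m),
    MeasurableSpace.comap
      (fun ω => Z i (dyadicPoint m l) ω - Z i (dyadicPoint m k) ω) inferInstance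

/-- The increments of the coordinates `i` and `j` at level `n` are at most `Δ_n^{α'}`. -/
def SmallIncrements {Ω : Type*} {d : ℕ} (Z : Fin d → Set.Icc (0 : ℝ) 1 → Ω → ℝ)
    (i j : Fin d) (n : ℕ) (α' : ℝ) (ω : Ω) : Prop :=
  ∀ r : ℕ, 1 ≤ r → r ≤ 2 ^ n →
    |dyadicIncr Z i n r ω| ≤ mesh n ^ α' ∧ |dyadicIncr Z j n r ω| ≤ mesh n ^ α'

/-- The partial sums of the products of increments at level `n` over `l < r ≤ q` are at most
`ε₀ (q - l)^β Δ_n^{2α'}`. -/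
def SmallProductSums {Ω : Type*} {d : ℕ} (Z : Fin d → Set.Icc (0 : ℝ) 1 → Ω → ℝ)
    (i j : Fin d) (n : ℕ) (α' β ε₀ : ℝ) (ω : Ω) : Prop :=
  ∀ l q : ℕ, l < q → q ≤ 2 ^ n →
    |∑ r ∈ Finset.Icc (l + 1) q, dyadicIncr Z i n r ω * dyadicIncr Z j n r ω|
      ≤ ε₀ * ((q : ℝ) - (l : ℝ)) ^ β * mesh n ^ (2 * α')

/-!
Conditioning on `𝓕_n` amounts to fixing the increments of level `n`. Up to scaling, these are the
means, over the blocks of cells of level `n + m` inside one cell of level `n`, of the Gaussian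
white noise `W` formed by the increments of level `n + m`. The deviations of `W` from its block
means are independent of the block means, so that, given `𝓕_n`, the increment of the random walk
is `∑ r, (a (p r) + D (p r)) * (a (q r) + D (q r))` with `p r` and `q r` cells of level `n + m`,
where `a` is constant and `D` is the vector of deviations.

The entries of `D` are correlated within a block. Adding an independent copy of the block means
turns `D` into white noise and, since `p r` and `q r` always lie in different blocks, leaves the
conditional mean of the sum given `D` unchanged; by Jensen's inequality it can only increase the
exponential moment. The resulting moment factorises over `r`, and each factor is explicit. For `K`
summands and variance `v`, the Chernoff bound with `θ = 1 / (2 v √K)` keeps the product of the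
normalising factors at most `2`, because `(1 - 1 / (4 K)) ^ K ≥ 3 / 4`.

There remains the contribution of the block means, which is a constant given `𝓕_n`. The full
blocks are controlled by `SmallProductSums`, the two incomplete blocks at the ends by
`SmallIncrements`.
-/

open scoped ENNReal NNReal

section GaussianMoments

lemma gaussianPDFReal_mul_exp_quadratic {v : ℝ≥0} (hv : v ≠ 0) (μ κ p : ℝ)
    (hκ : 0 < 1 - 2 * κ * v) (x : ℝ) :
    gaussianPDFReal μ v x * Real.exp (κ * x ^ 2 + p * x) =
      (√(1 - 2 * κ * v))⁻¹ * Real.exp ((p ^ 2 * v / 2 + p * μ + κ * μ ^ 2) / (1 - 2 * κ * v)) *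
        gaussianPDFReal ((μ + p * v) / (1 - 2 * κ * v)) (v / (1 - 2 * κ * v).toNNReal) x := by
  set δ : ℝ := 1 - 2 * κ * v with hδ
  have hv₀ : (v : ℝ) ≠ 0 := by exact_mod_cast hv
  have hsqrt : √(2 * Real.pi * (v / δ)) = √(2 * Real.pi * v) / √δ := by
    rw [← Real.sqrt_div (by positivity), mul_div_assoc]
  have hexponent : -(x - μ) ^ 2 / (2 * v) + (κ * x ^ 2 + p * x) =
      (p ^ 2 * v / 2 + p * μ + κ * μ ^ 2) / δ + -(x - (μ + p * v) / δ) ^ 2 / (2 * (v / δ)) := by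
    have hκδ : κ = (1 - δ) / (2 * v) := by rw [hδ]; field_simp; ring
    rw [hκδ]
    field_simp
    ring
  rw [gaussianPDFReal, mul_assoc, ← Real.exp_add, hexponent, Real.exp_add, gaussianPDFReal,
    NNReal.coe_div, Real.coe_toNNReal _ hκ.le, hsqrt]
  field_simp

lemma lintegral_exp_quadratic_gaussianReal (μ : ℝ) (v : ℝ≥0) (κ p : ℝ)
    (hκ : 0 < 1 - 2 * κ * v) :
    ∫⁻ x, ENNReal.ofReal (Real.exp (κ * x ^ 2 + p * x)) ∂gaussianReal μ v =
      ENNReal.ofReal ((√(1 - 2 * κ * v))⁻¹ *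
        Real.exp ((p ^ 2 * v / 2 + p * μ + κ * μ ^ 2) / (1 - 2 * κ * v))) := by
  rcases eq_or_ne v 0 with rfl | hv
  · rw [gaussianReal_zero_var, lintegral_dirac]
    simp [add_comm]
  have htilt (x : ℝ) : (gaussianPDF μ v * fun x ↦
      ENNReal.ofReal (Real.exp (κ * x ^ 2 + p * x))) x =
      ENNReal.ofReal ((√(1 - 2 * κ * v))⁻¹ *
        Real.exp ((p ^ 2 * v / 2 + p * μ + κ * μ ^ 2) / (1 - 2 * κ * v))) *
      gaussianPDF ((μ + p * v) / (1 - 2 * κ * v)) (v / (1 - 2 * κ * v).toNNReal) x := by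
    rw [Pi.mul_apply, gaussianPDF, gaussianPDF, ← ENNReal.ofReal_mul (gaussianPDFReal_nonneg _ _ _),
      ← ENNReal.ofReal_mul (by positivity), gaussianPDFReal_mul_exp_quadratic hv μ κ p hκ]
  rw [gaussianReal_of_var_ne_zero _ hv,
    lintegral_withDensity_eq_lintegral_mul _ (measurable_gaussianPDF μ v) (by fun_prop)]
  simp_rw [htilt]
  rw [lintegral_const_mul _ (measurable_gaussianPDF _ _), lintegral_gaussianPDF_eq_one, mul_one]
  exact div_ne_zero hv (Real.toNNReal_pos.2 hκ).ne'

variable {Ω : Type*} [MeasurableSpace Ω] {P : Measure Ω}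

lemma lintegral_exp_mul_of_indepFun [IsFiniteMeasure P] {U V : Ω → ℝ} {a b : ℝ} {v w : ℝ≥0}
    (hU : HasLaw U (gaussianReal a v) P) (hV : HasLaw V (gaussianReal b w) P)
    (hUV : IndepFun U V P) (θ : ℝ) (hθ : 0 < 1 - θ ^ 2 * v * w) :
    ∫⁻ ω, ENNReal.ofReal (Real.exp (θ * (U ω * V ω))) ∂P =
      ENNReal.ofReal ((√(1 - θ ^ 2 * v * w))⁻¹ * Real.exp
        ((θ * (a * b) + θ ^ 2 / 2 * (w * a ^ 2 + v * b ^ 2)) / (1 - θ ^ 2 * v * w))) := by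
  have hinner (u : ℝ) : ∫⁻ y, ENNReal.ofReal (Real.exp (θ * (u * y))) ∂gaussianReal b w =
      ENNReal.ofReal (Real.exp (θ ^ 2 * w / 2 * u ^ 2 + θ * b * u)) := by
    have := lintegral_exp_quadratic_gaussianReal b w 0 (θ * u) (by simp)
    simp only [zero_mul, zero_add, mul_zero, sub_zero, Real.sqrt_one, inv_one, one_mul, div_one,
      add_zero, mul_assoc θ u] at this
    rw [this]
    ring_nf
  have hδ : 1 - 2 * (θ ^ 2 * w / 2) * v = 1 - θ ^ 2 * v * w := by ring
  rw [(hUV.hasLaw_prod hU hV).lintegral_comp (by fun_prop)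
      (f := fun z : ℝ × ℝ ↦ ENNReal.ofReal (Real.exp (θ * (z.1 * z.2)))),
    lintegral_prod _ (by fun_prop)]
  simp_rw [hinner]
  rw [lintegral_exp_quadratic_gaussianReal _ _ _ _ (hδ ▸ hθ), hδ]
  ring_nf

end GaussianMoments

section Independence

lemma iIndepFun_prodMk_of_injective {Ω ι ρ E : Type*} [MeasurableSpace Ω] [MeasurableSpace E]
    {P : Measure Ω} {X : ι → Ω → E} (hX : iIndepFun X P) (hm : ∀ s, Measurable (X s))
    {p q : ρ → ι} (hpq : Function.Injective (Sum.elim p q)) :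
    iIndepFun (fun r ω ↦ (X (p r) ω, X (q r) ω)) P := by
  classical
  let pair (r : ρ) (ω : Ω) : E × E := (X (p r) ω, X (q r) ω)
  let rectangles : Set (Set (E × E)) :=
    Set.image2 (· ×ˢ ·) {A | MeasurableSet A} {B | MeasurableSet B}
  have hrectangles (s : Finset ρ) (A B : ρ → Set E) (hA : ∀ r ∈ s, MeasurableSet (A r))
      (hB : ∀ r ∈ s, MeasurableSet (B r)) : P (⋂ r ∈ s, pair r ⁻¹' (A r ×ˢ B r)) =
      (∏ r ∈ s, P (X (p r) ⁻¹' A r)) * ∏ r ∈ s, P (X (q r) ⁻¹' B r) := by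
    have hfactor := (hX.precomp hpq).measure_inter_preimage_eq_mul (s.disjSum s)
      (sets := Sum.elim A B) (by rintro (r | r) hr <;> simp_all)
    rw [Finset.prod_disjSum] at hfactor
    simp only [Sum.elim_inl, Sum.elim_inr] at hfactor
    rw [← hfactor]
    congr 1
    ext ω
    simp [pair, forall_and]
  rw [iIndepFun_iff_iIndep]
  refine iIndepSets.iIndep (fun r ↦ ((hm _).prodMk (hm _)).comap_le)
    (fun r ↦ Set.preimage (pair r) '' rectangles) (fun r ↦ isPiSystem_prod.comap (pair r))
    (fun r ↦ ?_) ?_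
  · rw [← MeasurableSpace.comap_generateFrom, generateFrom_prod]
  rw [iIndepSets_iff]
  intro s f hf
  have hsides : ∀ r ∈ s, ∃ A B, MeasurableSet A ∧ MeasurableSet B ∧ pair r ⁻¹' (A ×ˢ B) = f r := by
    intro r hr
    obtain ⟨_, ⟨A, hA, B, hB, rfl⟩, hAB⟩ := hf r hr
    exact ⟨A, B, hA, hB, hAB⟩
  choose! A B hA hB hAB using hsides
  rw [Set.iInter₂_congr fun r hr ↦ (hAB r hr).symm, hrectangles s A B hA hB,
    ← Finset.prod_mul_distrib]
  refine Finset.prod_congr rfl fun r hr ↦ ?_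
  simpa [← hAB r hr] using (hrectangles {r} A B (by simpa using hA r hr)
    (by simpa using hB r hr)).symm

lemma lintegral_prod_pair_of_iIndepFun {Ω ι ρ E : Type*} [MeasurableSpace Ω] [MeasurableSpace E]
    {P : Measure Ω} {X : ι → Ω → E} (hX : iIndepFun X P) (hm : ∀ s, Measurable (X s))
    {p q : ρ → ι} (hpq : Function.Injective (Sum.elim p q)) {f : ρ → E × E → ℝ≥0∞}
    (hf : ∀ r, Measurable (f r)) (s : Finset ρ) :
    ∫⁻ ω, ∏ r ∈ s, f r (X (p r) ω, X (q r) ω) ∂P =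
      ∏ r ∈ s, ∫⁻ ω, f r (X (p r) ω, X (q r) ω) ∂P :=
  lintegral_prod_eq_prod_lintegral_of_indepFun s _
    ((iIndepFun_prodMk_of_injective hX hm hpq).comp f hf)
    fun r ↦ (hf r).comp ((hm _).prodMk (hm _))

lemma ofReal_exp_integral_le_lintegral {Ω : Type*} [MeasurableSpace Ω] {P : Measure Ω}
    [IsProbabilityMeasure P] {f : Ω → ℝ} (hf : Integrable f P) :
    ENNReal.ofReal (Real.exp (∫ ω, f ω ∂P)) ≤ ∫⁻ ω, ENNReal.ofReal (Real.exp (f ω)) ∂P := by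
  have hexp_nonneg : 0 ≤ᵐ[P] fun ω ↦ Real.exp (f ω) := ae_of_all _ fun _ ↦ (Real.exp_pos _).le
  by_cases hexp : Integrable (fun ω ↦ Real.exp (f ω)) P
  · rw [← ofReal_integral_eq_lintegral_ofReal hexp hexp_nonneg]
    exact ENNReal.ofReal_le_ofReal (convexOn_exp.map_integral_le Real.continuous_exp.continuousOn
      isClosed_univ (by simp) hf hexp)
  · have htop : ¬ ∫⁻ ω, ENNReal.ofReal (Real.exp (f ω)) ∂P < ∞ := fun hlt ↦ hexp
      ⟨Real.continuous_exp.comp_aestronglyMeasurable hf.1,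
        (hasFiniteIntegral_iff_ofReal hexp_nonneg).2 hlt⟩
    rw [not_lt_top_iff.1 htop]
    exact le_top

lemma lintegral_exp_integral_le_of_indepFun {Ω E F : Type*} [MeasurableSpace Ω]
    [MeasurableSpace E] [MeasurableSpace F] {P : Measure Ω} [IsProbabilityMeasure P]
    {X : Ω → E} {Y : Ω → F} (hX : Measurable X) (hY : Measurable Y) (hXY : IndepFun X Y P)
    {f : E × F → ℝ} (hf : Measurable f) (hint : ∀ ω, Integrable (fun ω' ↦ f (X ω', Y ω)) P) :
    ∫⁻ ω, ENNReal.ofReal (Real.exp (∫ ω', f (X ω', Y ω) ∂P)) ∂P ≤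
      ∫⁻ ω, ENNReal.ofReal (Real.exp (f (X ω, Y ω))) ∂P := by
  have := Measure.isProbabilityMeasure_map (μ := P) hX.aemeasurable
  have := Measure.isProbabilityMeasure_map (μ := P) hY.aemeasurable
  have hg : Measurable fun z ↦ ENNReal.ofReal (Real.exp (f z)) := by fun_prop
  calc ∫⁻ ω, ENNReal.ofReal (Real.exp (∫ ω', f (X ω', Y ω) ∂P)) ∂P
      ≤ ∫⁻ ω, ∫⁻ ω', ENNReal.ofReal (Real.exp (f (X ω', Y ω))) ∂P ∂P :=
        lintegral_mono fun ω ↦ ofReal_exp_integral_le_lintegral (hint ω)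
    _ = ∫⁻ ω, ∫⁻ x, ENNReal.ofReal (Real.exp (f (x, Y ω))) ∂P.map X ∂P :=
        lintegral_congr fun ω ↦ (lintegral_map (hg.comp measurable_prodMk_right) hX).symm
    _ = ∫⁻ y, ∫⁻ x, ENNReal.ofReal (Real.exp (f (x, y))) ∂P.map X ∂P.map Y :=
        (lintegral_map hg.lintegral_prod_left' hY).symm
    _ = ∫⁻ z, ENNReal.ofReal (Real.exp (f z)) ∂P.map fun ω ↦ (X ω, Y ω) := by
        rw [← lintegral_prod_symm' _ hg,
          (indepFun_iff_map_prod_eq_prod_map_map hX.aemeasurable hY.aemeasurable).1 hXY]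
    _ = ∫⁻ ω, ENNReal.ofReal (Real.exp (f (X ω, Y ω))) ∂P := lintegral_map hg (hX.prodMk hY)

lemma condExp_indicator_of_indepFun {Ω E F : Type*} [MeasurableSpace Ω] [MeasurableSpace E]
    [MeasurableSpace F] [StandardBorelSpace F] {P : Measure Ω} [IsProbabilityMeasure P]
    {X : Ω → E} {Y : Ω → F} (hX : Measurable X) (hY : Measurable Y) (hXY : IndepFun X Y P)
    {B : Set (E × F)} (hB : MeasurableSet B) :
    P⟦{ω | (X ω, Y ω) ∈ B} | MeasurableSpace.comap X inferInstance⟧ =ᵐ[P]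
      fun ω ↦ P.real {ω' | (X ω, Y ω') ∈ B} := by
  have : Nonempty F := (nonempty_of_isProbabilityMeasure P).map Y
  have hlaw : P.map (fun ω ↦ (X ω, Y ω)) = P.map X ⊗ₘ Kernel.const E (P.map Y) := by
    rw [(indepFun_iff_map_prod_eq_prod_map_map hX.aemeasurable hY.aemeasurable).1 hXY,
      Measure.compProd_const]
  have hcondDistrib := ae_of_ae_map hX.aemeasurable
    (condDistrib_ae_eq_of_measure_eq_compProd_of_measurable hX hY hlaw)
  have hcondExp := condExp_prod_ae_eq_integral_condDistrib (μ := P) hX hY.aemeasurable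
    (f := B.indicator fun _ ↦ (1 : ℝ)) (stronglyMeasurable_const.indicator hB)
    ((integrable_const (1 : ℝ)).indicator ((hX.prodMk hY) hB))
  filter_upwards [hcondExp, hcondDistrib] with ω hω hωdistrib
  have hsection : MeasurableSet {y | (X ω, y) ∈ B} := measurable_prodMk_left hB
  calc (P⟦{ω | (X ω, Y ω) ∈ B} | MeasurableSpace.comap X inferInstance⟧) ω
      = ∫ y, B.indicator (fun _ ↦ (1 : ℝ)) (X ω, y) ∂condDistrib Y X P (X ω) := hω
    _ = ∫ y, {y | (X ω, y) ∈ B}.indicator 1 y ∂P.map Y := by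
        rw [hωdistrib, Kernel.const_apply]; rfl
    _ = P.real {ω' | (X ω, Y ω') ∈ B} := by
        rw [integral_indicator_one hsection, map_measureReal_apply hY hsection]; rfl

end Independence

section Moments

variable {Ω : Type*} [MeasurableSpace Ω] {P : Measure Ω}

lemma integral_const_add_mul_const_add_of_covariance_eq_zero [IsProbabilityMeasure P]
    {U V : Ω → ℝ} (hU : MemLp U 2 P) (hV : MemLp V 2 P) (hU₀ : ∫ ω, U ω ∂P = 0)
    (hV₀ : ∫ ω, V ω ∂P = 0) (hUV : cov[U, V; P] = 0) (a b : ℝ) :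
    ∫ ω, (a + U ω) * (b + V ω) ∂P = a * b := by
  have hcov : cov[fun ω ↦ a + U ω, fun ω ↦ b + V ω; P] = 0 := by
    rw [covariance_const_add_left (hU.integrable one_le_two),
      covariance_const_add_right (hV.integrable one_le_two), hUV]
  have hsub := covariance_eq_sub ((memLp_const a).add hU) ((memLp_const b).add hV)
  rw [show cov[(fun _ ↦ a) + U, (fun _ ↦ b) + V; P] = 0 from hcov, eq_comm, sub_eq_zero] at hsub
  refine hsub.trans ?_
  simp only [Pi.add_apply]
  rw [integral_add (integrable_const a) (hU.integrable one_le_two),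
    integral_add (integrable_const b) (hV.integrable one_le_two), hU₀, hV₀]
  simp

lemma measureReal_lt_abs_le_of_lintegral_exp_le [IsFiniteMeasure P] {S : Ω → ℝ}
    (hS : Measurable S) {B θ : ℝ} (hB : 0 ≤ B) (hθ : 0 ≤ θ)
    (hexp : ∀ η, |η| = θ → ∫⁻ ω, ENNReal.ofReal (Real.exp (η * S ω)) ∂P ≤ ENNReal.ofReal B)
    (T : ℝ) : P.real {ω | T < |S ω|} ≤ 2 * (Real.exp (-θ * T) * B) := by
  have hnonneg (η : ℝ) : 0 ≤ᵐ[P] fun ω ↦ Real.exp (η * S ω) := ae_of_all _ fun _ ↦ by positivity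
  have hint (η : ℝ) (hη : |η| = θ) : Integrable (fun ω ↦ Real.exp (η * S ω)) P :=
    ⟨by fun_prop, (hasFiniteIntegral_iff_ofReal (hnonneg η)).2
      ((hexp η hη).trans_lt ENNReal.ofReal_lt_top)⟩
  have hmgf (η : ℝ) (hη : |η| = θ) : mgf S P η ≤ B := by
    refine (ENNReal.ofReal_le_ofReal_iff hB).1 ?_
    rw [mgf, ofReal_integral_eq_lintegral_ofReal (hint η hη) (hnonneg η)]
    exact hexp η hη
  have hupper : P.real {ω | T ≤ S ω} ≤ Real.exp (-θ * T) * B :=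
    (measure_ge_le_exp_mul_mgf T hθ (hint θ (abs_of_nonneg hθ))).trans
      (by gcongr; exact hmgf θ (abs_of_nonneg hθ))
  have hlower : P.real {ω | S ω ≤ -T} ≤ Real.exp (-θ * T) * B := by
    have habs : |-θ| = θ := by rw [abs_neg, abs_of_nonneg hθ]
    have hchernoff := measure_le_le_exp_mul_mgf (-T) (neg_nonpos.2 hθ) (hint (-θ) habs)
    rw [neg_neg, mul_neg, ← neg_mul] at hchernoff
    exact hchernoff.trans (by gcongr; exact hmgf (-θ) habs)
  have hsubset : {ω | T < |S ω|} ⊆ {ω | T ≤ S ω} ∪ {ω | S ω ≤ -T} := fun ω hω ↦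
    (lt_abs.1 hω).imp le_of_lt fun h ↦ (le_neg.1 h.le : S ω ≤ -T)
  calc P.real {ω | T < |S ω|} ≤ P.real {ω | T ≤ S ω} + P.real {ω | S ω ≤ -T} :=
        (measureReal_mono hsubset).trans (measureReal_union_le _ _)
    _ ≤ 2 * (Real.exp (-θ * T) * B) := by rw [two_mul]; exact add_le_add hupper hlower

lemma inv_sqrt_one_sub_pow_le_two (K : ℕ) : (√(1 - 1 / (4 * (K : ℝ))))⁻¹ ^ K ≤ 2 := by
  rcases K.eq_zero_or_pos with rfl | hK
  · simp
  have hK₁ : (1 : ℝ) ≤ K := by exact_mod_cast hK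
  have hsmall : 1 / (4 * (K : ℝ)) ≤ 1 / 4 := one_div_le_one_div_of_le (by norm_num) (by linarith)
  have hbernoulli : 3 / 4 ≤ (1 - 1 / (4 * (K : ℝ))) ^ K := by
    have := one_add_mul_le_pow (a := -(1 / (4 * (K : ℝ)))) (by linarith) K
    have hprod : (K : ℝ) * -(1 / (4 * K)) = -(1 / 4) := by field_simp
    rw [hprod, ← sub_eq_add_neg, ← sub_eq_add_neg] at this
    exact le_trans (by norm_num) this
  have hsqrt : 1 / 2 ≤ √(1 - 1 / (4 * (K : ℝ))) ^ K := by
    refine le_of_sq_le_sq ?_ (by positivity)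
    rw [pow_right_comm, Real.sq_sqrt (by linarith)]
    exact le_trans (by norm_num) hbernoulli
  rw [inv_pow]
  exact inv_le_of_inv_le₀ (by norm_num) (by linarith)

end Moments

section GaussianNoise

/-- Gaussian white noise: independent centred Gaussian variables with common variance `v`. -/
structure IsGaussianNoise {Ω ι : Type*} [MeasurableSpace Ω] (W : ι → Ω → ℝ) (v : ℝ≥0)
    (P : Measure Ω) : Prop where
  measurable : ∀ s, Measurable (W s)
  indep : iIndepFun W P
  hasLaw : ∀ s, HasLaw (W s) (gaussianReal 0 v) P

namespace IsGaussianNoise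

variable {Ω ι : Type*} [MeasurableSpace Ω] {W : ι → Ω → ℝ} {v : ℝ≥0} {P : Measure Ω}

lemma memLp_two (h : IsGaussianNoise W v P) (s : ι) : MemLp (W s) 2 P :=
  (h.hasLaw s).hasGaussianLaw.memLp_two

lemma integral_eq_zero (h : IsGaussianNoise W v P) (s : ι) : ∫ ω, W s ω ∂P = 0 := by
  rw [(h.hasLaw s).integral_eq, integral_id_gaussianReal]

lemma covariance_eq [DecidableEq ι] (h : IsGaussianNoise W v P) (s t : ι) :
    cov[W s, W t; P] = if s = t then (v : ℝ) else 0 := by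
  split_ifs with hst
  · subst hst
    rw [covariance_self (h.measurable s).aemeasurable, (h.hasLaw s).variance_eq,
      variance_id_gaussianReal]
  · have := h.indep.isProbabilityMeasure
    exact (h.indep.indepFun hst).covariance_eq_zero (h.memLp_two s) (h.memLp_two t)

end IsGaussianNoise

end GaussianNoise

section BlockMeans

variable {Ω ι κ : Type*} [Fintype ι] [DecidableEq κ]

/-- The mean of the vector `w` over the block `π ⁻¹' {b}` of indices. For the increments of
Brownian motion at level `n + m`, the block means are the increments at level `n`, up to a
constant factor. On an empty block the mean is `0`. -/
noncomputable def blockMean (π : ι → κ) (w : ι → ℝ) (b : κ) : ℝ :=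
  (∑ s with π s = b, w s) / ({s | π s = b} : Finset ι).card

/-- The deviations of the entries of `w` from the means of their blocks. For Gaussian noise they
are independent of the block means. -/
noncomputable def blockDeviation (π : ι → κ) (w : ι → ℝ) (s : ι) : ℝ :=
  w s - blockMean π w (π s)

@[fun_prop]
lemma continuous_blockMean (π : ι → κ) : Continuous (blockMean π) := by
  unfold blockMean
  fun_prop

@[fun_prop]
lemma continuous_blockDeviation (π : ι → κ) : Continuous (blockDeviation π) := by
  unfold blockDeviation
  fun_prop

namespace IsGaussianNoise

variable [MeasurableSpace Ω] {W : ι → Ω → ℝ} {v : ℝ≥0} {P : Measure Ω}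

lemma measurable_blockMean (h : IsGaussianNoise W v P) (π : ι → κ) :
    Measurable fun ω ↦ blockMean π (W · ω) := by
  have := h.measurable
  unfold blockMean
  fun_prop

lemma measurable_blockDeviation (h : IsGaussianNoise W v P) (π : ι → κ) :
    Measurable fun ω ↦ blockDeviation π (W · ω) := by
  have := h.measurable
  unfold blockDeviation blockMean
  fun_prop

lemma memLp_two_blockMean (h : IsGaussianNoise W v P) (π : ι → κ) (b : κ) :
    MemLp (fun ω ↦ blockMean π (W · ω) b) 2 P := by
  simp only [blockMean, div_eq_mul_inv]
  exact (memLp_finsetSum _ fun s _ ↦ h.memLp_two s).mul_const _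

lemma integral_blockMean (h : IsGaussianNoise W v P) (π : ι → κ) (b : κ) :
    ∫ ω, blockMean π (W · ω) b ∂P = 0 := by
  have := h.indep.isProbabilityMeasure
  simp only [blockMean]
  rw [integral_div, integral_finsetSum _ fun s _ ↦ (h.memLp_two s).integrable one_le_two]
  simp [h.integral_eq_zero]

lemma covariance_blockMean_right (h : IsGaussianNoise W v P) (π : ι → κ) (s : ι) (b : κ) :
    cov[W s, fun ω ↦ blockMean π (W · ω) b; P] =
      if π s = b then (v : ℝ) / ({t | π t = b} : Finset ι).card else 0 := by
  classical
  have := h.indep.isProbabilityMeasure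
  simp only [blockMean]
  rw [covariance_fun_div_right,
    covariance_fun_sum_right' (fun t _ ↦ h.memLp_two t) (h.memLp_two s)]
  simp [h.covariance_eq, ite_div]

lemma covariance_blockMean_blockMean (h : IsGaussianNoise W v P) (π : ι → κ) (b c : κ) :
    cov[fun ω ↦ blockMean π (W · ω) b, fun ω ↦ blockMean π (W · ω) c; P] =
      if b = c then (v : ℝ) / ({t | π t = c} : Finset ι).card else 0 := by
  have := h.indep.isProbabilityMeasure
  calc cov[fun ω ↦ blockMean π (W · ω) b, fun ω ↦ blockMean π (W · ω) c; P]
      = (∑ s with π s = b, cov[W s, fun ω ↦ blockMean π (W · ω) c; P]) /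
          ({s | π s = b} : Finset ι).card := by
        rw [← covariance_fun_sum_left' (fun t _ ↦ h.memLp_two t) (h.memLp_two_blockMean π c),
          ← covariance_fun_div_left]
        rfl
    _ = (∑ s with π s = b, if b = c then (v : ℝ) / ({t | π t = c} : Finset ι).card else 0) /
          ({s | π s = b} : Finset ι).card := by
        congr 1
        refine Finset.sum_congr rfl fun s hs ↦ ?_
        rw [h.covariance_blockMean_right, (Finset.mem_filter.1 hs).2]
    _ = if b = c then (v : ℝ) / ({t | π t = c} : Finset ι).card else 0 := by
        rw [Finset.sum_const, nsmul_eq_mul]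
        split_ifs with hbc
        · subst hbc
          rcases eq_or_ne (({s | π s = b} : Finset ι).card : ℝ) 0 with hcard | hcard
          · simp [hcard]
          · exact mul_div_cancel_left₀ _ hcard
        · simp

lemma covariance_blockMean_blockDeviation (h : IsGaussianNoise W v P) (π : ι → κ) (b : κ)
    (s : ι) : cov[fun ω ↦ blockMean π (W · ω) b, fun ω ↦ blockDeviation π (W · ω) s; P] = 0 := by
  have := h.indep.isProbabilityMeasure
  simp only [blockDeviation]
  rw [covariance_fun_sub_right (h.memLp_two_blockMean π b) (h.memLp_two s)
    (h.memLp_two_blockMean π (π s)), covariance_comm, h.covariance_blockMean_right,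
    h.covariance_blockMean_blockMean, sub_eq_zero]
  split_ifs <;> simp_all

lemma indepFun_blockMean_blockDeviation [Finite κ] (h : IsGaussianNoise W v P) (π : ι → κ) :
    IndepFun (fun ω ↦ blockMean π (W · ω)) (fun ω ↦ blockDeviation π (W · ω)) P := by
  have := Fintype.ofFinite κ
  let L : (ι → ℝ) →L[ℝ] (κ → ℝ) × (ι → ℝ) :=
    { toFun w := (blockMean π w, blockDeviation π w)
      map_add' w w' := by
        ext <;> simp only [blockDeviation, blockMean, Prod.mk_add_mk, Pi.add_apply,
          Finset.sum_add_distrib] <;> ring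
      map_smul' a w := by
        ext <;> simp only [blockDeviation, blockMean, Prod.smul_mk, Pi.smul_apply, smul_eq_mul,
          ← Finset.mul_sum, RingHom.id_apply] <;> ring }
  have hW : HasGaussianLaw (fun ω ↦ (W · ω)) P :=
    h.indep.hasGaussianLaw fun s ↦ (h.hasLaw s).hasGaussianLaw
  have hpair : HasGaussianLaw
      (fun ω ↦ (blockMean π (W · ω), blockDeviation π (W · ω))) P := hW.map L
  exact hpair.indepFun_of_covariance_eval (h.covariance_blockMean_blockDeviation π)

end IsGaussianNoise

end BlockMeans

section PairSum

variable {Ω ι κ ρ : Type*} [Fintype ρ]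

/-- The off-diagonal quadratic form `∑ r, w (p r) * w (q r)`. The difference of two values of
`areaWalk` is of this form in the increments of the finest level involved. -/
def pairSum (p q : ρ → ι) (w : ι → ℝ) : ℝ := ∑ r, w (p r) * w (q r)

variable [MeasurableSpace Ω] {W : ι → Ω → ℝ} {v : ℝ≥0} {P : Measure Ω} {p q : ρ → ι}

namespace IsGaussianNoise

lemma lintegral_exp_pairSum_const_add (h : IsGaussianNoise W v P)
    (hinj : Function.Injective (Sum.elim p q)) (a : ι → ℝ) (θ : ℝ)
    (hθ : 0 < 1 - (θ * v) ^ 2) :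
    ∫⁻ ω, ENNReal.ofReal (Real.exp (θ * pairSum p q fun s ↦ a s + W s ω)) ∂P =
      ENNReal.ofReal ((√(1 - (θ * v) ^ 2))⁻¹ ^ Fintype.card ρ * Real.exp
        ((θ * pairSum p q a + θ ^ 2 * v / 2 * ∑ r, (a (p r) ^ 2 + a (q r) ^ 2)) /
          (1 - (θ * v) ^ 2))) := by
  have := h.indep.isProbabilityMeasure
  have hδ : 1 - θ ^ 2 * v * v = 1 - (θ * v) ^ 2 := by ring
  have hlaw (s : ι) : HasLaw (fun ω ↦ a s + W s ω) (gaussianReal (a s) v) P := by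
    simpa using gaussianReal_const_add (h.hasLaw s) (a s)
  have hpair (r : ρ) :
      ∫⁻ ω, ENNReal.ofReal (Real.exp (θ * ((a (p r) + W (p r) ω) * (a (q r) + W (q r) ω)))) ∂P =
        ENNReal.ofReal ((√(1 - (θ * v) ^ 2))⁻¹ * Real.exp ((θ * (a (p r) * a (q r)) +
          θ ^ 2 * v / 2 * (a (p r) ^ 2 + a (q r) ^ 2)) / (1 - (θ * v) ^ 2))) := by
    have hpq : p r ≠ q r := fun e ↦ Sum.inl_ne_inr (hinj (a₁ := .inl r) (a₂ := .inr r) e)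
    have hindep := (h.indep.indepFun hpq).comp (measurable_const_add (a (p r)))
      (measurable_const_add (a (q r)))
    rw [lintegral_exp_mul_of_indepFun (hlaw _) (hlaw _) hindep θ (hδ ▸ hθ), hδ]
    ring_nf
  simp only [pairSum, Finset.mul_sum, Real.exp_sum]
  simp_rw [ENNReal.ofReal_prod_of_nonneg fun _ _ ↦ (Real.exp_pos _).le]
  rw [lintegral_prod_pair_of_iIndepFun h.indep h.measurable hinj
    (f := fun r z ↦ ENNReal.ofReal (Real.exp (θ * ((a (p r) + z.1) * (a (q r) + z.2)))))
    fun r ↦ by fun_prop]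
  simp_rw [hpair]
  rw [← ENNReal.ofReal_prod_of_nonneg fun _ _ ↦ by positivity, Finset.prod_mul_distrib,
    Finset.prod_const, ← Real.exp_sum, ← Finset.sum_div, Finset.sum_add_distrib, Finset.card_univ]

variable [Fintype ι] [DecidableEq κ] {π : ι → κ}

lemma integrable_const_add_blockMean_mul (h : IsGaussianNoise W v P) (π : ι → κ) (a a' : ℝ)
    (b b' : κ) :
    Integrable (fun ω ↦ (a + blockMean π (W · ω) b) * (a' + blockMean π (W · ω) b')) P := by
  have := h.indep.isProbabilityMeasure
  have hmemLp (a : ℝ) (b : κ) : MemLp (fun ω ↦ a + blockMean π (W · ω) b) 2 P :=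
    (memLp_const a).add (h.memLp_two_blockMean π b)
  exact (hmemLp a b).integrable_mul (hmemLp a' b')

lemma integrable_pairSum_add_blockMean (h : IsGaussianNoise W v P) (π : ι → κ) (u : ι → ℝ) :
    Integrable (fun ω ↦ pairSum p q fun s ↦ u s + blockMean π (W · ω) (π s)) P :=
  integrable_finsetSum _ fun _ _ ↦ h.integrable_const_add_blockMean_mul π _ _ _ _

lemma integral_pairSum_add_blockMean (h : IsGaussianNoise W v P)
    (hpq : ∀ r, π (p r) ≠ π (q r)) (u : ι → ℝ) :
    ∫ ω, pairSum p q (fun s ↦ u s + blockMean π (W · ω) (π s)) ∂P = pairSum p q u := by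
  have := h.indep.isProbabilityMeasure
  simp only [pairSum]
  rw [integral_finsetSum _ fun _ _ ↦ h.integrable_const_add_blockMean_mul π _ _ _ _]
  refine Finset.sum_congr rfl fun r _ ↦ ?_
  refine integral_const_add_mul_const_add_of_covariance_eq_zero (h.memLp_two_blockMean π _)
    (h.memLp_two_blockMean π _) (h.integral_blockMean π _) (h.integral_blockMean π _) ?_ _ _
  rw [h.covariance_blockMean_blockMean, if_neg (hpq r)]

lemma lintegral_exp_pairSum_blockDeviation_le [Finite κ] (h : IsGaussianNoise W v P)
    (hpq : ∀ r, π (p r) ≠ π (q r)) (a : ι → ℝ) (θ : ℝ) :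
    ∫⁻ ω, ENNReal.ofReal (Real.exp (θ *
        pairSum p q fun s ↦ a s + blockDeviation π (W · ω) s)) ∂P ≤
      ∫⁻ ω, ENNReal.ofReal (Real.exp (θ * pairSum p q fun s ↦ a s + W s ω)) ∂P := by
  have := h.indep.isProbabilityMeasure
  have := Fintype.ofFinite κ
  let f (z : (κ → ℝ) × (ι → ℝ)) : ℝ := θ * pairSum p q fun s ↦ a s + z.2 s + z.1 (π s)
  have hf : Measurable f := by
    unfold f pairSum
    fun_prop
  have hint (ω : Ω) :
      Integrable (fun ω' ↦ f (blockMean π (W · ω'), blockDeviation π (W · ω))) P :=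
    (h.integrable_pairSum_add_blockMean π fun s ↦ a s + blockDeviation π (W · ω) s).const_mul θ
  have hjensen := lintegral_exp_integral_le_of_indepFun (h.measurable_blockMean π)
    (h.measurable_blockDeviation π) (h.indepFun_blockMean_blockDeviation π) hf hint
  have hsplit (ω : Ω) (s : ι) :
      a s + blockDeviation π (W · ω) s + blockMean π (W · ω) (π s) = a s + W s ω := by
    rw [blockDeviation, add_assoc, sub_add_cancel]
  simpa only [f, integral_const_mul, h.integral_pairSum_add_blockMean hpq, hsplit] using hjensen

end IsGaussianNoise

lemma pairSum_exponent_le [Nonempty ρ] {v : ℝ≥0} (hv : v ≠ 0) {a : ι → ℝ} {A C η : ℝ}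
    (hA : ∀ r, |a (p r)| ≤ A ∧ |a (q r)| ≤ A) (hC : |pairSum p q a| ≤ C)
    (hη : |η| = 1 / (2 * v * √(Fintype.card ρ))) :
    (η * pairSum p q a + η ^ 2 * v / 2 * ∑ r, (a (p r) ^ 2 + a (q r) ^ 2)) /
        (1 - (η * v) ^ 2) ≤
      4 / 3 * C / (2 * v * √(Fintype.card ρ)) + A ^ 2 / (3 * v) := by
  have : (0 : ℝ) < v := by positivity
  have hK : (1 : ℝ) ≤ Fintype.card ρ := by exact_mod_cast Fintype.card_pos
  have hsq : η ^ 2 = 1 / (4 * v ^ 2 * Fintype.card ρ) := by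
    rw [← sq_abs, hη, div_pow, mul_pow, Real.sq_sqrt (by linarith)]
    ring
  have hδ : 3 / 4 ≤ 1 - (η * v) ^ 2 := by
    have hprod : (η * v) ^ 2 = 1 / (4 * Fintype.card ρ) := by rw [mul_pow, hsq]; field_simp
    have := one_div_le_one_div_of_le (by norm_num : (0 : ℝ) < 4)
      (by linarith : 4 ≤ 4 * (Fintype.card ρ : ℝ))
    linarith
  have hlinear : η * pairSum p q a ≤ C / (2 * v * √(Fintype.card ρ)) := by
    calc η * pairSum p q a ≤ |η| * |pairSum p q a| := (le_abs_self _).trans (abs_mul _ _).le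
      _ ≤ 1 / (2 * v * √(Fintype.card ρ)) * C := by rw [hη]; gcongr
      _ = C / (2 * v * √(Fintype.card ρ)) := by ring
  have hsum : ∑ r, (a (p r) ^ 2 + a (q r) ^ 2) ≤ Fintype.card ρ * (2 * A ^ 2) := by
    refine (Finset.sum_le_card_nsmul _ _ (2 * A ^ 2) fun r _ ↦ ?_).trans (by simp)
    linarith [sq_le_sq' (abs_le.1 (hA r).1).1 (abs_le.1 (hA r).1).2,
      sq_le_sq' (abs_le.1 (hA r).2).1 (abs_le.1 (hA r).2).2]
  have hquadratic : η ^ 2 * v / 2 * ∑ r, (a (p r) ^ 2 + a (q r) ^ 2) ≤ A ^ 2 / (4 * v) := by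
    calc η ^ 2 * v / 2 * ∑ r, (a (p r) ^ 2 + a (q r) ^ 2)
        ≤ η ^ 2 * v / 2 * (Fintype.card ρ * (2 * A ^ 2)) := by gcongr
      _ = A ^ 2 / (4 * v) := by rw [hsq]; field_simp
  have hC₀ : 0 ≤ C := (abs_nonneg _).trans hC
  calc (η * pairSum p q a + η ^ 2 * v / 2 * ∑ r, (a (p r) ^ 2 + a (q r) ^ 2)) / (1 - (η * v) ^ 2)
      ≤ (C / (2 * v * √(Fintype.card ρ)) + A ^ 2 / (4 * v)) / (1 - (η * v) ^ 2) := by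
        gcongr
    _ ≤ (C / (2 * v * √(Fintype.card ρ)) + A ^ 2 / (4 * v)) / (3 / 4) := by gcongr
    _ = 4 / 3 * C / (2 * v * √(Fintype.card ρ)) + A ^ 2 / (3 * v) := by field_simp

namespace IsGaussianNoise

variable [Fintype ι] [DecidableEq κ] [Finite κ] {π : ι → κ}

lemma measureReal_lt_abs_pairSum_blockDeviation_le [Nonempty ρ] (h : IsGaussianNoise W v P)
    (hv : v ≠ 0) (hinj : Function.Injective (Sum.elim p q)) (hpq : ∀ r, π (p r) ≠ π (q r))
    {a : ι → ℝ} {A C : ℝ} (hA : ∀ r, |a (p r)| ≤ A ∧ |a (q r)| ≤ A)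
    (hC : |pairSum p q a| ≤ C) (T : ℝ) :
    P.real {ω | T < |pairSum p q fun s ↦ a s + blockDeviation π (W · ω) s|} ≤
      4 * Real.exp ((4 / 3 * C - T) / (2 * v * √(Fintype.card ρ)) + A ^ 2 / (3 * v)) := by
  have := h.indep.isProbabilityMeasure
  have hK : (1 : ℝ) ≤ Fintype.card ρ := by exact_mod_cast Fintype.card_pos
  set θ : ℝ := 1 / (2 * v * √(Fintype.card ρ)) with hθ
  set E : ℝ := 4 / 3 * C / (2 * v * √(Fintype.card ρ)) + A ^ 2 / (3 * v) with hE
  have hS : Measurable fun ω ↦ pairSum p q fun s ↦ a s + blockDeviation π (W · ω) s := by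
    have (s : ι) := (measurable_pi_apply s).comp (h.measurable_blockDeviation π)
    unfold pairSum
    fun_prop
  have hmoment (η : ℝ) (hη : |η| = θ) : ∫⁻ ω, ENNReal.ofReal (Real.exp (η *
      pairSum p q fun s ↦ a s + blockDeviation π (W · ω) s)) ∂P ≤
        ENNReal.ofReal (2 * Real.exp E) := by
    have hηv : (η * v) ^ 2 = 1 / (4 * (Fintype.card ρ : ℝ)) := by
      rw [mul_pow, ← sq_abs, hη, hθ, div_pow, mul_pow, Real.sq_sqrt (by linarith)]
      field_simp
      norm_num
    have hδ : 0 < 1 - (η * v) ^ 2 := by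
      rw [hηv, sub_pos, div_lt_one] <;> linarith
    refine (h.lintegral_exp_pairSum_blockDeviation_le hpq a η).trans ?_
    rw [h.lintegral_exp_pairSum_const_add hinj a η hδ]
    gcongr
    · exact hηv ▸ inv_sqrt_one_sub_pow_le_two _
    · exact pairSum_exponent_le hv hA hC hη
  refine (measureReal_lt_abs_le_of_lintegral_exp_le hS (by positivity) (by positivity) hmoment
    T).trans_eq ?_
  calc 2 * (Real.exp (-θ * T) * (2 * Real.exp E)) = 4 * Real.exp (-θ * T + E) := by
        rw [Real.exp_add (-θ * T) E]; ring
    _ = _ := by rw [hθ, hE]; congr 2; ring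

lemma ae_condExp_lt_abs_pairSum_le [Nonempty ρ] (h : IsGaussianNoise W v P) (hv : v ≠ 0)
    (hinj : Function.Injective (Sum.elim p q)) (hpq : ∀ r, π (p r) ≠ π (q r)) (A C T : ℝ) :
    ∀ᵐ ω ∂P,
      (∀ r, |blockMean π (W · ω) (π (p r))| ≤ A ∧ |blockMean π (W · ω) (π (q r))| ≤ A) →
      |pairSum p q fun s ↦ blockMean π (W · ω) (π s)| ≤ C →
      (P⟦{ω' | T < |pairSum p q (W · ω')|} |
          MeasurableSpace.comap (fun ω ↦ blockMean π (W · ω)) inferInstance⟧) ω ≤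
        4 * Real.exp ((4 / 3 * C - T) / (2 * v * √(Fintype.card ρ)) + A ^ 2 / (3 * v)) := by
  have := h.indep.isProbabilityMeasure
  have := Fintype.ofFinite κ
  let B : Set ((κ → ℝ) × (ι → ℝ)) := {z | T < |pairSum p q fun s ↦ z.1 (π s) + z.2 s|}
  have hB : MeasurableSet B := by
    refine measurableSet_lt measurable_const ?_
    unfold pairSum
    fun_prop
  have hsplit : {ω | T < |pairSum p q (W · ω)|} =
      {ω | (blockMean π (W · ω), blockDeviation π (W · ω)) ∈ B} := by
    simp [B, blockDeviation]
  filter_upwards [condExp_indicator_of_indepFun (h.measurable_blockMean π)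
    (h.measurable_blockDeviation π) (h.indepFun_blockMean_blockDeviation π) hB] with ω hω hA hC
  rw [hsplit, hω]
  exact h.measureReal_lt_abs_pairSum_blockDeviation_le hv hinj hpq hA hC T

end IsGaussianNoise

end PairSum

section BlockConstantSums

lemma sum_range_div {E : Type*} [AddCommMonoid E] (f : ℕ → E) {M : ℕ} (hM : 0 < M) (k : ℕ) :
    ∑ r ∈ Finset.range k, f (r / M) =
      M • ∑ b ∈ Finset.range (k / M), f b + (k % M) • f (k / M) := by
  have hblock (q s : ℕ) (hs : s ≤ M) :
      ∑ r ∈ Finset.range s, f ((M * q + r) / M) = s • f q := by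
    rw [Finset.sum_congr rfl (g := fun _ ↦ f q), Finset.sum_const, Finset.card_range]
    intro r hr
    rw [Nat.mul_add_div hM, Nat.div_eq_of_lt ((Finset.mem_range.1 hr).trans_le hs), add_zero]
  have hfull (q : ℕ) :
      ∑ r ∈ Finset.range (M * q), f (r / M) = M • ∑ b ∈ Finset.range q, f b := by
    induction q with
    | zero => simp
    | succ q ih =>
      rw [Nat.mul_succ, Finset.sum_range_add, ih, hblock q M le_rfl, Finset.sum_range_succ,
        nsmul_add]
  conv_lhs => rw [← Nat.div_add_mod k M]
  rw [Finset.sum_range_add, hfull, hblock _ _ (Nat.mod_lt k hM).le]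

lemma div_sub_div_le_sub {M k k' : ℕ} (hM : 0 < M) (hkk' : k ≤ k') :
    k' / M - k / M ≤ k' - k := by
  have hgap : k' ≤ k + (k' - k) * M := by
    have := Nat.le_mul_of_pos_right (k' - k) hM
    omega
  have := Nat.div_le_div_right (c := M) hgap
  rw [Nat.add_mul_div_right _ _ hM] at this
  omega

lemma norm_mod_nsmul_div_le {E : Type*} [SeminormedAddCommGroup E] {f : ℕ → E} {M N a : ℕ}
    {F : ℝ} (hM : 0 < M) (ha : a ≤ N * M) (hF₀ : 0 ≤ F) (hF : ∀ b < N, ‖f b‖ ≤ F) :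
    ‖(a % M) • f (a / M)‖ ≤ M * F := by
  rcases (a % M).eq_zero_or_pos with hmod | hmod
  · rw [hmod, zero_nsmul, norm_zero]
    positivity
  · have hlt : a / M < N := by
      refine (Nat.div_lt_iff_lt_mul hM).2 (lt_of_le_of_ne ha ?_)
      rintro rfl
      simp at hmod
    refine norm_nsmul_le.trans ?_
    gcongr
    exacts [(Nat.mod_lt a hM).le, hF _ hlt]

lemma norm_sum_Ico_div_le {E : Type*} [SeminormedAddCommGroup E] {f : ℕ → E} {M N k k' : ℕ}
    {F : ℝ} {Φ : ℕ → ℝ} (hM : 0 < M) (hkk' : k < k') (hk' : k' ≤ N * M)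
    (hF : ∀ b < N, ‖f b‖ ≤ F) (hΦ : Monotone Φ)
    (hS : ∀ l q, l < q → q ≤ N → ‖∑ b ∈ Finset.Ico l q, f b‖ ≤ Φ (q - l)) :
    ‖∑ r ∈ Finset.Ico k k', f (r / M)‖ ≤ M * Φ (k' - k) + 2 * M * F := by
  have hkk'_div : k / M ≤ k' / M := Nat.div_le_div_right hkk'.le
  have hk'N : k' / M ≤ N := Nat.div_le_of_le_mul (by rwa [mul_comm])
  have hN : 0 < N := Nat.pos_of_mul_pos_right (by omega : 0 < N * M)
  have hF₀ : 0 ≤ F := (norm_nonneg _).trans (hF 0 hN)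
  have hΦ₀ : 0 ≤ Φ (k' - k) :=
    ((norm_nonneg _).trans (hS 0 1 one_pos hN)).trans (hΦ (by omega))
  have hfull : ‖∑ b ∈ Finset.Ico (k / M) (k' / M), f b‖ ≤ Φ (k' - k) := by
    rcases hkk'_div.eq_or_lt with heq | hlt
    · simpa [heq] using hΦ₀
    · exact (hS _ _ hlt hk'N).trans (hΦ (div_sub_div_le_sub hM hkk'.le))
  have hsplit : ∑ r ∈ Finset.Ico k k', f (r / M) =
      M • ∑ b ∈ Finset.Ico (k / M) (k' / M), f b + (k' % M) • f (k' / M) -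
        (k % M) • f (k / M) := by
    rw [Finset.sum_Ico_eq_sub _ hkk'.le, sum_range_div f hM, sum_range_div f hM,
      Finset.sum_Ico_eq_sub _ hkk'_div, nsmul_sub]
    abel
  calc ‖∑ r ∈ Finset.Ico k k', f (r / M)‖
      ≤ ‖M • ∑ b ∈ Finset.Ico (k / M) (k' / M), f b‖ + ‖(k' % M) • f (k' / M)‖ +
          ‖(k % M) • f (k / M)‖ := by
        rw [hsplit]
        exact (norm_sub_le _ _).trans (by gcongr; exact norm_add_le _ _)
    _ ≤ M * Φ (k' - k) + M * F + M * F := by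
        gcongr
        · exact norm_nsmul_le.trans (by gcongr)
        · exact norm_mod_nsmul_div_le hM hk' hF₀ hF
        · exact norm_mod_nsmul_div_le hM (hkk'.le.trans hk') hF₀ hF
    _ = M * Φ (k' - k) + 2 * M * F := by ring

end BlockConstantSums

section DyadicGrid

lemma mesh_pos (n : ℕ) : 0 < mesh n := by
  unfold mesh
  positivity

lemma mesh_le_one (n : ℕ) : mesh n ≤ 1 := by
  unfold mesh
  exact div_le_one_of_le₀ (one_le_pow₀ one_le_two) (by positivity)

lemma mesh_add (n m : ℕ) : mesh (n + m) = mesh n * mesh m := by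
  unfold mesh
  rw [pow_add]
  field_simp

lemma mesh_succ_mul_two_pow (n : ℕ) : mesh (n + 1) * 2 ^ n = 1 / 2 := by
  unfold mesh
  rw [pow_succ]
  field_simp

lemma mesh_succ_le_half (n : ℕ) : mesh (n + 1) ≤ 1 / 2 := by
  rw [← mesh_succ_mul_two_pow n]
  exact le_mul_of_one_le_right (mesh_pos _).le (one_le_pow₀ one_le_two)

lemma dyadicPoint_monotone (n : ℕ) : Monotone (dyadicPoint n) := fun _ _ _ ↦
  Set.monotone_projIcc _ (by gcongr)

lemma coe_dyadicPoint {n k : ℕ} (hk : k ≤ 2 ^ n) : (dyadicPoint n k : ℝ) = k * mesh n := by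
  have hmem : (k : ℝ) / 2 ^ n ∈ Set.Icc 0 1 :=
    ⟨by positivity, div_le_one_of_le₀ (by exact_mod_cast hk) (by positivity)⟩
  rw [dyadicPoint, Set.projIcc_of_mem zero_le_one hmem, mesh, mul_one_div]

lemma dyadicPoint_add (n m k : ℕ) : dyadicPoint (n + m) (k * 2 ^ m) = dyadicPoint n k := by
  unfold dyadicPoint
  congr 1
  push_cast
  rw [pow_add, mul_div_mul_right _ _ (by positivity)]

/-- The cell of level `n` containing a cell of level `n + m`. A cell `(l, s)` of level `n` stands
for coordinate `l` and the interval from `dyadicPoint n s` to `dyadicPoint n (s + 1)`. -/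
def dyadicBlock (d n m : ℕ) (x : Fin d × Fin (2 ^ (n + m))) : Fin d × Fin (2 ^ n) :=
  (x.1, ⟨x.2 / 2 ^ m, Nat.div_lt_of_lt_mul (x.2.2.trans_eq (by rw [← pow_add, add_comm]))⟩)

lemma sum_filter_dyadicBlock {E : Type*} [AddCommMonoid E] {d n m : ℕ} (g : Fin d → ℕ → E)
    (b : Fin d × Fin (2 ^ n)) :
    ∑ x with dyadicBlock d n m x = b, g x.1 x.2 =
      ∑ t ∈ Finset.range (2 ^ m), g b.1 (2 ^ m * b.2 + t) := by
  have hpos : 0 < 2 ^ m := by positivity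
  have hlt (t : ℕ) (ht : t ∈ Finset.range (2 ^ m)) : 2 ^ m * b.2 + t < 2 ^ (n + m) := by
    have ht := Finset.mem_range.1 ht
    have hb := Nat.mul_le_mul_left (2 ^ m) b.2.2
    rw [Nat.mul_succ, ← pow_add, add_comm m n] at hb
    omega
  refine (Finset.sum_bij (fun t ht ↦ (b.1, ⟨2 ^ m * b.2 + t, hlt t ht⟩)) ?_ ?_ ?_ ?_).symm
  · intro t ht
    refine Finset.mem_filter.2 ⟨Finset.mem_univ _, Prod.ext rfl (Fin.ext ?_)⟩
    change (2 ^ m * (b.2 : ℕ) + t) / 2 ^ m = b.2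
    rw [Nat.mul_add_div hpos, Nat.div_eq_of_lt (Finset.mem_range.1 ht), add_zero]
  · intro t _ t' _ htt'
    simpa using htt'
  · rintro ⟨l, s⟩ hx
    obtain rfl := (Finset.mem_filter.1 hx).2
    exact ⟨s % 2 ^ m, Finset.mem_range.2 (Nat.mod_lt _ hpos),
      Prod.ext rfl (Fin.ext (Nat.div_add_mod _ _))⟩
  · exact fun _ _ ↦ rfl

lemma card_filter_dyadicBlock {d n m : ℕ} (b : Fin d × Fin (2 ^ n)) :
    ({x | dyadicBlock d n m x = b} : Finset _).card = 2 ^ m := by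
  rw [Finset.card_eq_sum_ones, sum_filter_dyadicBlock (fun _ _ ↦ 1) b]
  simp

end DyadicGrid

section DyadicNoise

variable {Ω : Type*} {d : ℕ}

/-- The increments over the cells of level `n`, which for independent Brownian motions form a
Gaussian noise generating `dyadicSigma Z n`. A cell `(l, s)` has the 0-based index `s`, hence the
shift by one. -/
noncomputable def dyadicNoise (Z : Fin d → Set.Icc (0 : ℝ) 1 → Ω → ℝ) (n : ℕ)
    (x : Fin d × Fin (2 ^ n)) (ω : Ω) : ℝ :=
  dyadicIncr Z x.1 n (x.2 + 1) ω

variable {Z : Fin d → Set.Icc (0 : ℝ) 1 → Ω → ℝ}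

lemma sum_range_dyadicIncr (l : Fin d) (n a c : ℕ) (ω : Ω) :
    ∑ t ∈ Finset.range c, dyadicIncr Z l n (a + t + 1) ω =
      Z l (dyadicPoint n (a + c)) ω - Z l (dyadicPoint n a) ω := by
  simpa [dyadicIncr, add_assoc] using
    Finset.sum_range_sub (fun t ↦ Z l (dyadicPoint n (a + t)) ω) c

lemma blockMean_dyadicNoise (n m : ℕ) (b : Fin d × Fin (2 ^ n)) (ω : Ω) :
    blockMean (dyadicBlock d n m) (dyadicNoise Z (n + m) · ω) b =
      mesh m * dyadicNoise Z n b ω := by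
  have hsum : ∑ x with dyadicBlock d n m x = b, dyadicNoise Z (n + m) x ω =
      dyadicNoise Z n b ω := by
    simp only [dyadicNoise]
    rw [sum_filter_dyadicBlock (fun l s ↦ dyadicIncr Z l (n + m) (s + 1) ω) b,
      sum_range_dyadicIncr, ← Nat.mul_succ, mul_comm (2 ^ m), mul_comm (2 ^ m), dyadicPoint_add,
      dyadicPoint_add]
    rfl
  rw [blockMean, hsum, card_filter_dyadicBlock, mesh]
  push_cast
  ring

lemma measurable_comap_dyadicNoise {n m : ℕ} (hmn : m ≤ n) (l : Fin d) {a b : ℕ}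
    (ha : a ≤ 2 ^ m) (hb : b ≤ 2 ^ m) :
    Measurable[MeasurableSpace.comap (fun ω ↦ (dyadicNoise Z n · ω)) inferInstance]
      fun ω ↦ Z l (dyadicPoint m b) ω - Z l (dyadicPoint m a) ω := by
  obtain ⟨e, rfl⟩ := Nat.exists_eq_add_of_le hmn
  let 𝓖 := MeasurableSpace.comap (fun ω ↦ (dyadicNoise Z (m + e) · ω)) inferInstance
  have hcell (x : Fin d × Fin (2 ^ (m + e))) : Measurable[𝓖] (dyadicNoise Z (m + e) x) :=
    (measurable_pi_apply (X := fun _ ↦ ℝ) x).comp (comap_measurable fun ω ↦ (dyadicNoise Z _ · ω))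
  have hfromZero (c : ℕ) (hc : c ≤ 2 ^ m) :
      Measurable[𝓖] fun ω ↦ Z l (dyadicPoint m c) ω - Z l (dyadicPoint m 0) ω := by
    have htelescope (ω : Ω) : ∑ t ∈ Finset.range (c * 2 ^ e), dyadicIncr Z l (m + e) (t + 1) ω =
        Z l (dyadicPoint m c) ω - Z l (dyadicPoint m 0) ω := by
      simpa [← dyadicPoint_add m e] using sum_range_dyadicIncr (Z := Z) l (m + e) 0 (c * 2 ^ e) ω
    simp_rw [← htelescope]
    refine Finset.measurable_sum _ fun t ht ↦ hcell (l, ⟨t, (Finset.mem_range.1 ht).trans_le ?_⟩)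
    rw [pow_add]
    exact Nat.mul_le_mul_right _ hc
  simpa only [Pi.sub_def, sub_sub_sub_cancel_right] using (hfromZero b hb).sub (hfromZero a ha)

lemma dyadicSigma_eq_comap_dyadicNoise (n : ℕ) :
    dyadicSigma Z n = MeasurableSpace.comap (fun ω ↦ (dyadicNoise Z n · ω)) inferInstance := by
  apply le_antisymm
  · simp only [dyadicSigma, iSup_le_iff]
    intro m hm l a ha b hb
    exact (measurable_comap_dyadicNoise hm l ha hb).comap_le
  · refine Measurable.comap_le (@measurable_pi_lambda _ _ _ (dyadicSigma Z n) _ _ fun x ↦ ?_)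
    refine Measurable.of_comap_le ?_
    exact le_iSup₂_of_le n le_rfl <| le_iSup_of_le x.1 <| le_iSup₂_of_le (x.2 : ℕ) x.2.2.le <|
      le_iSup₂_of_le ((x.2 : ℕ) + 1) x.2.2 le_rfl

lemma dyadicSigma_eq_comap_blockMean (n m : ℕ) :
    dyadicSigma Z n = MeasurableSpace.comap
      (fun ω ↦ blockMean (dyadicBlock d n m) (dyadicNoise Z (n + m) · ω)) inferInstance := by
  let scaling : (Fin d × Fin (2 ^ n) → ℝ) ≃ᵐ (Fin d × Fin (2 ^ n) → ℝ) :=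
    MeasurableEquiv.smul₀ (mesh m) (mesh_pos m).ne'
  have hscaling : (fun ω ↦ blockMean (dyadicBlock d n m) (dyadicNoise Z (n + m) · ω)) =
      scaling ∘ fun ω ↦ (dyadicNoise Z n · ω) :=
    funext₂ fun ω b ↦ blockMean_dyadicNoise n m b ω
  rw [dyadicSigma_eq_comap_dyadicNoise, hscaling, ← MeasurableSpace.comap_comp,
    scaling.measurableEmbedding.comap_eq]

lemma isGaussianNoise_dyadicNoise [MeasurableSpace Ω] {P : Measure Ω}
    (hZ : IsUnitBrownianFamily Z P) (n : ℕ) :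
    IsGaussianNoise (dyadicNoise Z n) (mesh n).toNNReal P where
  measurable x := ((hZ.brownian x.1).measurable _).sub ((hZ.brownian x.1).measurable _)
  indep := by
    refine iIndepFun_uncurry' (X := fun l (s : Fin (2 ^ n)) ω ↦ dyadicIncr Z l n (s + 1) ω)
      (fun l s ↦ ((hZ.brownian l).measurable _).sub ((hZ.brownian l).measurable _)) ?_ ?_
    · exact hZ.indep.comp (fun _ (z : Set.Icc (0 : ℝ) 1 → ℝ) (s : Fin (2 ^ n)) ↦
        z (dyadicPoint n (s + 1)) - z (dyadicPoint n s)) fun _ ↦ by fun_prop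
    · intro l
      exact ((hZ.brownian l).indep_increments.nat (dyadicPoint_monotone n)).precomp
        Fin.val_injective
  hasLaw x := by
    have hincr := (hZ.brownian x.1).gaussian_increments (dyadicPoint n x.2)
      (dyadicPoint n (x.2 + 1)) (dyadicPoint_monotone n (Nat.le_succ _))
    have hlength : (dyadicPoint n (x.2 + 1) : ℝ) - dyadicPoint n x.2 = mesh n := by
      rw [coe_dyadicPoint x.2.2, coe_dyadicPoint x.2.2.le]
      push_cast
      ring
    rwa [hlength] at hincr

end DyadicNoise

section AreaWalk

variable {Ω : Type*} {d : ℕ} {Z : Fin d → Set.Icc (0 : ℝ) 1 → Ω → ℝ} {i j : Fin d}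
  {n m k k' : ℕ} {α' β ε₀ : ℝ} {ω : Ω}

/-- The cell `(l, 2 r + e)` of level `n + 1`. The `r`-th summand of `areaWalk Z i j (n + 1)`,
counted from `0`, is the product of the increments over `walkCell k hk' i 0 r` and
`walkCell k hk' j 1 r`. -/
def walkCell (k : ℕ) (hk' : k' ≤ 2 ^ n) (l : Fin d) (e : Fin 2) (r : Finset.Ico k k') :
    Fin d × Fin (2 ^ (n + 1)) :=
  (l, ⟨2 * r + e, by have := (Finset.mem_Ico.1 r.2).2; rw [pow_succ]; omega⟩)

lemma areaWalk_sub_eq_pairSum (hkk' : k ≤ k') (hk' : k' ≤ 2 ^ n) :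
    areaWalk Z i j (n + 1) k' ω - areaWalk Z i j (n + 1) k ω =
      pairSum (walkCell k hk' i 0) (walkCell k hk' j 1) (dyadicNoise Z (n + 1) · ω) := by
  let summand (r : ℕ) : ℝ :=
    dyadicIncr Z i (n + 1) (2 * r + 1) ω * dyadicIncr Z j (n + 1) (2 * r + 2) ω
  have hrange (k : ℕ) : areaWalk Z i j (n + 1) k ω = ∑ r ∈ Finset.range k, summand r := by
    rw [Finset.range_eq_Ico]
    exact (Finset.sum_Ico_add' (fun r ↦ dyadicIncr Z i (n + 1) (2 * r - 1) ω *
      dyadicIncr Z j (n + 1) (2 * r) ω) 0 k 1).symm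
  rw [hrange, hrange, ← Finset.sum_Ico_eq_sub _ hkk', ← Finset.sum_coe_sort]
  rfl

lemma injective_sumElim_walkCell (hij : i ≠ j) (hk' : k' ≤ 2 ^ n) :
    Function.Injective (Sum.elim (walkCell k hk' i 0) (walkCell k hk' j 1)) := by
  have hinj (l : Fin d) (e : Fin 2) : Function.Injective (walkCell k hk' l e) := fun r r' h ↦ by
    have hval : 2 * (r : ℕ) + e = 2 * r' + e := congrArg (fun x ↦ (x.2 : ℕ)) h
    exact Subtype.ext (by omega)
  exact (hinj i 0).sumElim (hinj j 1) fun _ _ h ↦ hij (congrArg Prod.fst h)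

lemma div_two_pow_lt_of_mem_Ico (hk' : k' ≤ 2 ^ (n + m)) (r : Finset.Ico k k') :
    (r : ℕ) / 2 ^ m < 2 ^ n :=
  Nat.div_lt_of_lt_mul <| by
    rw [← pow_add, add_comm m n]
    exact (Finset.mem_Ico.1 r.2).2.trans_le hk'

lemma dyadicBlock_walkCell (hk' : k' ≤ 2 ^ (n + m)) (l : Fin d) (e : Fin 2)
    (r : Finset.Ico k k') :
    dyadicBlock d n (m + 1) (walkCell k hk' l e r) =
      (l, ⟨r / 2 ^ m, div_two_pow_lt_of_mem_Ico hk' r⟩) := by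
  refine Prod.ext rfl (Fin.ext ?_)
  have hhalf : (2 * (r : ℕ) + e) / 2 = r := by omega
  change (2 * (r : ℕ) + e) / 2 ^ (m + 1) = r / 2 ^ m
  rw [pow_succ', ← Nat.div_div_eq_div_mul, hhalf]

lemma blockMean_walkCell (hk' : k' ≤ 2 ^ (n + m)) (l : Fin d) (e : Fin 2)
    (r : Finset.Ico k k') :
    blockMean (dyadicBlock d n (m + 1)) (dyadicNoise Z (n + (m + 1)) · ω)
        (dyadicBlock d n (m + 1) (walkCell k hk' l e r)) =
      mesh (m + 1) * dyadicIncr Z l n (r / 2 ^ m + 1) ω := by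
  rw [blockMean_dyadicNoise, dyadicBlock_walkCell]
  rfl

lemma abs_blockMean_walkCell_le (hsmall : SmallIncrements Z i j n α' ω)
    (hk' : k' ≤ 2 ^ (n + m)) (r : Finset.Ico k k') :
    |blockMean (dyadicBlock d n (m + 1)) (dyadicNoise Z (n + (m + 1)) · ω)
        (dyadicBlock d n (m + 1) (walkCell k hk' i 0 r))| ≤ mesh (m + 1) * mesh n ^ α' ∧
      |blockMean (dyadicBlock d n (m + 1)) (dyadicNoise Z (n + (m + 1)) · ω)
        (dyadicBlock d n (m + 1) (walkCell k hk' j 1 r))| ≤ mesh (m + 1) * mesh n ^ α' := by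
  have hmesh := mesh_pos (m + 1)
  obtain ⟨hi, hj⟩ := hsmall (r / 2 ^ m + 1) (Nat.le_add_left 1 _) (div_two_pow_lt_of_mem_Ico hk' r)
  rw [blockMean_walkCell, blockMean_walkCell, abs_mul, abs_mul, abs_of_pos hmesh]
  exact ⟨by gcongr, by gcongr⟩

lemma abs_sum_Ico_dyadicIncr_mul_le (hβ : 0 ≤ β) (hε₀ : 0 ≤ ε₀)
    (hsmall : SmallIncrements Z i j n α' ω) (hproducts : SmallProductSums Z i j n α' β ε₀ ω)
    (hkk' : k < k') (hk' : k' ≤ 2 ^ (n + m)) :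
    |∑ r ∈ Finset.Ico k k',
        dyadicIncr Z i n (r / 2 ^ m + 1) ω * dyadicIncr Z j n (r / 2 ^ m + 1) ω| ≤
      2 ^ m * mesh n ^ (2 * α') * (ε₀ * ((k' : ℝ) - k) ^ β + 2) := by
  have hmesh (a : ℝ) : 0 < mesh n ^ a := Real.rpow_pos_of_pos (mesh_pos n) a
  let product (b : ℕ) : ℝ := dyadicIncr Z i n (b + 1) ω * dyadicIncr Z j n (b + 1) ω
  have hproduct : ∀ b < 2 ^ n, ‖product b‖ ≤ mesh n ^ (2 * α') := by
    intro b hb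
    obtain ⟨hi, hj⟩ := hsmall (b + 1) (Nat.le_add_left 1 b) hb
    rw [Real.norm_eq_abs, abs_mul, two_mul, Real.rpow_add (mesh_pos n)]
    exact mul_le_mul hi hj (abs_nonneg _) (hmesh α').le
  have hIco : ∀ l q, l < q → q ≤ 2 ^ n → ‖∑ b ∈ Finset.Ico l q, product b‖ ≤
      ε₀ * ((q - l : ℕ) : ℝ) ^ β * mesh n ^ (2 * α') := by
    intro l q hlq hq
    rw [Nat.cast_sub hlq.le, Finset.sum_Ico_add' fun r ↦
      dyadicIncr Z i n r ω * dyadicIncr Z j n r ω]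
    exact hproducts l q hlq hq
  have hmono : Monotone fun s : ℕ ↦ ε₀ * (s : ℝ) ^ β * mesh n ^ (2 * α') := by
    have := hmesh (2 * α')
    intro s t hst
    dsimp only
    gcongr
  have hblocks := norm_sum_Ico_div_le (M := 2 ^ m) (by positivity) hkk' (by rwa [← pow_add])
    hproduct hmono hIco
  rw [Nat.cast_sub hkk'.le] at hblocks
  refine hblocks.trans_eq ?_
  push_cast
  ring

lemma abs_pairSum_blockMean_walkCell_le (hβ : 0 ≤ β) (hε₀ : 0 ≤ ε₀)
    (hsmall : SmallIncrements Z i j n α' ω) (hproducts : SmallProductSums Z i j n α' β ε₀ ω)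
    (hkk' : k < k') (hk' : k' ≤ 2 ^ (n + m)) :
    |pairSum (walkCell k hk' i 0) (walkCell k hk' j 1) fun s ↦
        blockMean (dyadicBlock d n (m + 1)) (dyadicNoise Z (n + (m + 1)) · ω)
          (dyadicBlock d n (m + 1) s)| ≤
      mesh (m + 1) * mesh n ^ (2 * α') * (ε₀ * ((k' : ℝ) - k) ^ β / 2 + 1) := by
  have hpairSum : (pairSum (walkCell k hk' i 0) (walkCell k hk' j 1) fun s ↦
      blockMean (dyadicBlock d n (m + 1)) (dyadicNoise Z (n + (m + 1)) · ω)
        (dyadicBlock d n (m + 1) s)) = mesh (m + 1) ^ 2 * ∑ r ∈ Finset.Ico k k',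
          dyadicIncr Z i n (r / 2 ^ m + 1) ω * dyadicIncr Z j n (r / 2 ^ m + 1) ω := by
    simp only [pairSum, blockMean_walkCell]
    rw [← Finset.sum_coe_sort (Finset.Ico k k'), Finset.mul_sum]
    exact Finset.sum_congr rfl fun r _ ↦ by ring
  calc _ = mesh (m + 1) ^ 2 * |∑ r ∈ Finset.Ico k k',
          dyadicIncr Z i n (r / 2 ^ m + 1) ω * dyadicIncr Z j n (r / 2 ^ m + 1) ω| := by
        rw [hpairSum, abs_mul, abs_of_nonneg (by positivity)]
    _ ≤ mesh (m + 1) ^ 2 * (2 ^ m * mesh n ^ (2 * α') * (ε₀ * ((k' : ℝ) - k) ^ β + 2)) := by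
        gcongr
        exact abs_sum_Ico_dyadicIncr_mul_le hβ hε₀ hsmall hproducts hkk' hk'
    _ = _ := by
        linear_combination
          mesh (m + 1) * mesh n ^ (2 * α') * (ε₀ * ((k' : ℝ) - k) ^ β + 2) *
            mesh_succ_mul_two_pow m

end AreaWalk

section TailExponent

variable {α β α' ε₀ δ μ K : ℝ}

lemma rpow_mul_rpow_div_sqrt (hδ : 0 < δ) (hμ : 0 < μ) (hK : 0 < K) :
    K ^ β * (δ * μ) ^ (2 * α) / (2 * (δ * μ) * √K) = δ ^ (2 * α' - 1) *
      (K ^ (β - 1 / 2) * δ ^ (2 * (α - α')) * μ ^ (2 * α - 1)) / 2 := by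
  have hδα : δ ^ (2 * α) / δ = δ ^ (2 * α' - 1) * δ ^ (2 * (α - α')) := by
    rw [← Real.rpow_add hδ, ← Real.rpow_sub_one hδ.ne']
    ring_nf
  have hμα : μ ^ (2 * α) / μ = μ ^ (2 * α - 1) := (Real.rpow_sub_one hμ.ne' _).symm
  have hKβ : K ^ β / √K = K ^ (β - 1 / 2) := by rw [Real.rpow_sub hK, Real.sqrt_eq_rpow]
  calc K ^ β * (δ * μ) ^ (2 * α) / (2 * (δ * μ) * √K)
      = (K ^ β / √K) * (δ ^ (2 * α) / δ) * (μ ^ (2 * α) / μ) / 2 := by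
        rw [Real.mul_rpow hδ.le hμ.le]
        field_simp
    _ = _ := by rw [hδα, hμα, hKβ]; ring

lemma rpow_le_mul_rpow_mul_rpow (hα : α ≤ 1 / 2) (hαα' : α ≤ α') (hδ : 0 < δ) (hδ₁ : δ ≤ 1)
    (hμ : 0 < μ) (hμ₁ : μ ≤ 1) {y : ℝ} (hy : 0 ≤ y) :
    y ≤ y * δ ^ (2 * (α - α')) * μ ^ (2 * α - 1) := by
  have hδα : 1 ≤ δ ^ (2 * (α - α')) :=
    Real.one_le_rpow_of_pos_of_le_one_of_nonpos hδ hδ₁ (by linarith)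
  have hμα : 1 ≤ μ ^ (2 * α - 1) :=
    Real.one_le_rpow_of_pos_of_le_one_of_nonpos hμ hμ₁ (by linarith)
  rw [mul_assoc]
  exact le_mul_of_one_le_right hy (one_le_mul_of_one_le_of_one_le hδα hμα)

lemma tail_exponent_le (hα : α ≤ 1 / 2) (hαα' : α ≤ α') (hε₀ : ε₀ ≤ 1 / 2) (hδ : 0 < δ)
    (hδ₁ : δ ≤ 1) (hμ : 0 < μ) (hμ₁ : μ ≤ 1 / 2) (hK : 1 ≤ K) :
    (4 / 3 * (μ * δ ^ (2 * α') * (ε₀ * K ^ β / 2 + 1)) - K ^ β * (δ * μ) ^ (2 * α)) /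
        (2 * (δ * μ) * √K) + (μ * δ ^ α') ^ 2 / (3 * (δ * μ)) ≤
      δ ^ (2 * α' - 1) *
        (5 / 6 - K ^ (β - 1 / 2) * δ ^ (2 * (α - α')) * μ ^ (2 * α - 1) / 3) := by
  have hK₀ : 0 < K := by linarith
  set y : ℝ := K ^ (β - 1 / 2) with hy
  set ρ : ℝ := δ ^ (2 * α' - 1) with hρ
  set x : ℝ := y * δ ^ (2 * (α - α')) * μ ^ (2 * α - 1)
  have hρ₀ : 0 < ρ := Real.rpow_pos_of_pos hδ _
  have hy₀ : 0 < y := Real.rpow_pos_of_pos hK₀ _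
  have hyx : y ≤ x := rpow_le_mul_rpow_mul_rpow hα hαα' hδ hδ₁ hμ (by linarith) hy₀.le
  have hsqrt : 1 / √K ≤ 1 := (div_le_one (by positivity)).2 (Real.one_le_sqrt.2 hK)
  have hKβ : K ^ β = y * √K := by
    rw [hy, Real.sqrt_eq_rpow, ← Real.rpow_add hK₀, sub_add_cancel]
  have hδα' : δ ^ (2 * α') = ρ * δ := by rw [hρ, ← Real.rpow_add_one hδ.ne', sub_add_cancel]
  have hthreshold : K ^ β * (δ * μ) ^ (2 * α) / (2 * (δ * μ) * √K) = ρ * x / 2 :=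
    rpow_mul_rpow_div_sqrt hδ hμ hK₀
  have hmean : μ * δ ^ (2 * α') * (ε₀ * K ^ β / 2 + 1) / (2 * (δ * μ) * √K) =
      ρ * (ε₀ * y / 4 + 1 / √K / 2) := by
    rw [hδα', hKβ]
    field_simp
    ring
  have hblock : (μ * δ ^ α') ^ 2 / (3 * (δ * μ)) = ρ * μ / 3 := by
    have hsq : (δ ^ α') ^ 2 = ρ * δ := by
      rw [← hδα', mul_comm 2, Real.rpow_mul hδ.le, Real.rpow_two]
    rw [mul_pow, hsq]
    field_simp
  calc _ = 4 / 3 * (ρ * (ε₀ * y / 4 + 1 / √K / 2)) - ρ * x / 2 + ρ * μ / 3 := by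
        rw [sub_div, mul_div_assoc, hmean, hthreshold, hblock]
    _ = ρ * ((ε₀ * y + 2 * (1 / √K)) / 3 - x / 2 + μ / 3) := by ring
    _ ≤ ρ * (5 / 6 - x / 3) := by
        gcongr
        nlinarith

lemma le_eight_mul_exp {y x ρ γ : ℝ} (hy : y ≤ 1) (hρ : 1 ≤ ρ) (hx : 0 ≤ x) (hγ : γ ≤ 1 / 4)
    (hyx : y ≤ 4 * Real.exp (ρ * (5 / 6 - x / 3))) : y ≤ 8 * Real.exp (-(1 / 2) * γ * x) := by
  rcases le_total x 4 with hx₄ | hx₄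
  · have := Real.add_one_le_exp (-(1 / 2) * γ * x)
    nlinarith
  · have hexponent : ρ * (5 / 6 - x / 3) ≤ -(1 / 2) * γ * x := by nlinarith
    have := Real.exp_le_exp.2 hexponent
    linarith [Real.exp_pos (-(1 / 2) * γ * x)]

end TailExponent

section Tail

variable {Ω : Type*} [MeasurableSpace Ω] {P : Measure Ω} {d : ℕ}
  {Z : Fin d → Set.Icc (0 : ℝ) 1 → Ω → ℝ} {i j : Fin d} {α β α' ε₀ : ℝ} {n m k k' : ℕ}

lemma ae_condExp_areaWalk_sub_le
    (hW : IsGaussianNoise (dyadicNoise Z (n + (m + 1))) (mesh (n + (m + 1))).toNNReal P)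
    (hα : α ≤ 1 / 2) (hβ : 0 ≤ β) (hαα' : α ≤ α') (hε₀ : ε₀ ∈ Set.Icc (0 : ℝ) (1 / 2))
    (hij : i ≠ j) (hkk' : k < k') (hk' : k' ≤ 2 ^ (n + m)) :
    ∀ᵐ ω ∂P, SmallIncrements Z i j n α' ω → SmallProductSums Z i j n α' β ε₀ ω →
      (P⟦{ω' | |areaWalk Z i j (n + (m + 1)) k' ω' - areaWalk Z i j (n + (m + 1)) k ω'|
          > ((k' : ℝ) - k) ^ β * mesh (n + (m + 1)) ^ (2 * α)} | dyadicSigma Z n⟧) ω ≤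
        4 * Real.exp (mesh n ^ (2 * α' - 1) * (5 / 6 - ((k' : ℝ) - k) ^ (β - 1 / 2) *
          mesh n ^ (2 * (α - α')) * mesh (m + 1) ^ (2 * α - 1) / 3)) := by
  have hK : (1 : ℝ) ≤ (k' : ℝ) - k := by
    rw [← Nat.cast_sub hkk'.le]
    exact_mod_cast Nat.sub_pos_of_lt hkk'
  have hcard : (Fintype.card (Finset.Ico k k') : ℝ) = (k' : ℝ) - k := by
    rw [Fintype.card_coe, Nat.card_Ico, Nat.cast_sub hkk'.le]
  have hv : ((mesh (n + (m + 1))).toNNReal : ℝ) = mesh n * mesh (m + 1) := by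
    rw [Real.coe_toNNReal _ (mesh_pos _).le, mesh_add]
  have : Nonempty (Finset.Ico k k') := ⟨k, Finset.left_mem_Ico.2 hkk'⟩
  have htail := hW.ae_condExp_lt_abs_pairSum_le (π := dyadicBlock d n (m + 1))
    (Real.toNNReal_pos.2 (mesh_pos _)).ne' (injective_sumElim_walkCell (k := k) hij hk')
    (fun r h ↦ hij (congrArg Prod.fst h)) (mesh (m + 1) * mesh n ^ α')
    (mesh (m + 1) * mesh n ^ (2 * α') * (ε₀ * ((k' : ℝ) - k) ^ β / 2 + 1))
    (((k' : ℝ) - k) ^ β * mesh (n + (m + 1)) ^ (2 * α))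
  rw [dyadicSigma_eq_comap_blockMean n (m + 1)]
  filter_upwards [htail] with ω hω hsmall hproducts
  simp only [gt_iff_lt, ← add_assoc, areaWalk_sub_eq_pairSum hkk'.le hk']
  refine (hω (abs_blockMean_walkCell_le hsmall hk')
    (abs_pairSum_blockMean_walkCell_le hβ hε₀.1 hsmall hproducts hkk' hk')).trans ?_
  rw [hcard, hv, mesh_add n (m + 1)]
  gcongr
  exact tail_exponent_le hα hαα' hε₀.2 (mesh_pos n) (mesh_le_one n) (mesh_pos _)
    (mesh_succ_le_half m) hK

theorem mainTheorem5_general {γ : ℝ}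
    (hW : IsGaussianNoise (dyadicNoise Z (n + m)) (mesh (n + m)).toNNReal P)
    (hα : α ≤ 1 / 2) (hβ : 0 ≤ β) (hα' : α' ∈ Set.Icc α (1 / 2)) (hγ : γ ≤ 1 / 4)
    (hε₀ : ε₀ ∈ Set.Icc (0 : ℝ) (1 / 2)) (hij : i ≠ j) (hm : 1 ≤ m) (hkk' : k < k')
    (hk' : k' ≤ 2 ^ (n + m - 1)) :
    ∀ᵐ ω ∂P, SmallIncrements Z i j n α' ω → SmallProductSums Z i j n α' β ε₀ ω →
      (P⟦{ω' | |areaWalk Z i j (n + m) k' ω' - areaWalk Z i j (n + m) k ω'|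
          > ((k' : ℝ) - (k : ℝ)) ^ β * mesh (n + m) ^ (2 * α)} | dyadicSigma Z n⟧) ω
        ≤ 8 * Real.exp (-(1 / 2) * γ * ((k' : ℝ) - (k : ℝ)) ^ (β - 1 / 2)
            * mesh n ^ (2 * (α - α')) * mesh m ^ (2 * α - 1)) := by
  obtain ⟨m, rfl⟩ := Nat.exists_eq_add_of_le' hm
  have := hW.indep.isProbabilityMeasure
  have hK : 0 ≤ (k' : ℝ) - k := sub_nonneg.2 (by exact_mod_cast hkk'.le)
  have hmesh (l : ℕ) (a : ℝ) : 0 ≤ mesh l ^ a := Real.rpow_nonneg (mesh_pos l).le a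
  have hscale : 1 ≤ mesh n ^ (2 * α' - 1) :=
    Real.one_le_rpow_of_pos_of_le_one_of_nonpos (mesh_pos n) (mesh_le_one n) (by linarith [hα'.2])
  have hindicator (A : Set Ω) (ω : Ω) : |A.indicator (fun _ ↦ (1 : ℝ)) ω| ≤ 1 := by
    by_cases hω : ω ∈ A <;> simp [hω]
  filter_upwards [ae_condExp_areaWalk_sub_le hW hα hβ hα'.1 hε₀ hij hkk' hk',
    ae_bdd_abs_condExp_of_ae_bdd_abs (ae_of_all P (hindicator _))]
    with ω htail hone hsmall hproducts
  simpa only [mul_assoc] using le_eight_mul_exp (le_of_abs_le hone) hscale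
    (mul_nonneg (mul_nonneg (Real.rpow_nonneg hK _) (hmesh _ _)) (hmesh _ _)) hγ
    (htail hsmall hproducts)

end Tail

theorem mainTheorem5 {Ω : Type*} [MeasurableSpace Ω] (P : Measure Ω) [IsProbabilityMeasure P]
    {d : ℕ} (Z : Fin d → Set.Icc (0 : ℝ) 1 → Ω → ℝ) (hZ : IsUnitBrownianFamily Z P)
    (α β α' γ ε₀ : ℝ)
    (hα : α ∈ Set.Ioo (1 / 3 : ℝ) (1 / 2))
    (hβ : β ∈ Set.Ioo (1 - α) (2 * α))
    (hα' : α' ∈ Set.Ioo α (1 / 2))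
    (hγ : γ ∈ Set.Ioc (0 : ℝ) (1 / 4))
    (hε₀ : ε₀ ∈ Set.Ioo (0 : ℝ) (1 / 2))
    (i j : Fin d) (hij : i ≠ j)
    (n m : ℕ) (hm : 1 ≤ m)
    (k k' : ℕ) (hkk' : k < k') (hk' : k' ≤ 2 ^ (n + m - 1)) :
    ∀ᵐ ω ∂P, SmallIncrements Z i j n α' ω → SmallProductSums Z i j n α' β ε₀ ω →
      (P⟦{ω' | |areaWalk Z i j (n + m) k' ω' - areaWalk Z i j (n + m) k ω'|
          > ((k' : ℝ) - (k : ℝ)) ^ β * mesh (n + m) ^ (2 * α)} | dyadicSigma Z n⟧) ω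
        ≤ 8 * Real.exp (-(1 / 2) * γ * ((k' : ℝ) - (k : ℝ)) ^ (β - 1 / 2)
            * mesh n ^ (2 * (α - α')) * mesh m ^ (2 * α - 1)) :=
  mainTheorem5_general (isGaussianNoise_dyadicNoise hZ (n + m)) hα.2.le
    (by linarith [hβ.1, hα.2]) ⟨hα'.1.le, hα'.2.le⟩ hγ.2 ⟨hε₀.1.le, hε₀.2.le⟩ hij hm hkk' hk'
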